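/- Let $n\ge 2$, let $(N,g)$ be an $n$-dimensional (smooth) Riemannian manifold, and let $M$ be a $C^2$ (immersed, in particular possibly embedded) $n$-dimensional hypersurface in $N\times\mathbb{R}$. Write $t$ for the coordinate on $\mathbb{R}$, $\langle\cdot,\cdot\rangle=g+dt^2$ for the product metric, and let $\nu$ be a unit normal to $M$ in $(N\times\mathbb{R},g+dt^2)$. Let $\Sigma=M\cap\{t=\epsilon\}$ be a regular level set, i.e. the differential of $t|_M$ does not vanish at any point of $\Sigma$, regarded as a $C^2$ submanifold of $M$ of dimension $n-1$ and hence as a hypersurface in $N\times\{\epsilon\}\cong N$; let $\eta$ be a unit normal to $\Sigma$ in $(N\times\{\epsilon\},g)$. Let $\phi\in C^1(N\times\mathbb{R})$ be a positive function and $\phi_t=\partial\phi/\partial t$. For a hypersurface in a manifold with metric $h$ and Levi-Civita connection $\nabla$, with $h$-unit normal $\mu$ and coordinate frame $e_i$, the shape operator is $A^i_j=\sum_k h^{ik}\,h(\mu,\nabla_{e_k}e_j)$, where $(h^{ik})$ is the inverse of the matrix $(h(e_i,e_k))$; the mean curvature is $\operatorname{tr}A$, and $|A|^2=\sum_{i,j}A^i_jA^j_i$.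 Let $\bar A$ be the shape operator of $M$ in $(N\times\mathbb{R},\phi^{-2}(g+dt^2))$ with respect to the unit normal $\phi\nu$, let $\bar A_\Sigma$ be the shape operator of $\Sigma$ in $(N\times\{\epsilon\},\phi(\cdot,\epsilon)^{-2}g)$ with respect to the unit normal $\phi\eta$, and let $\bar H,\bar H_\Sigma$ be the corresponding mean curvatures. Then at every point of $\Sigma$ $$\bar H\,\big[\langle\nu,\eta\rangle\bar H_\Sigma+(n-1)\langle\nu,\partial_t\rangle\phi_t\big]\ \ge\ \tfrac12\big(\bar H^2-|\bar A|^2\big)+\frac{n}{2(n-1)}\big[\langle\nu,\eta\rangle\bar H_\Sigma+(n-1)\langle\nu,\partial_t\rangle\phi_t\big]^2 .$$ Equality holds at a point of $\Sigma$ if and only if, at that point, both of the following hold: (i) $\Sigma$ is umbilic in $(N\times\{\epsilon\},\phi(\cdot,\epsilon)^{-2}g)$, i.e. $\bar A_\Sigma=\kappa\,\mathrm{Id}$ for some $\kappa\in\mathbb{R}$; (ii) with this $\kappa$, the number $\langle\nu,\eta\rangle\kappa+\langle\nu,\partial_t\rangle\phi_t$ is a principal curvature of $M$ in $(N\times\mathbb{R},\phi^{-2}(g+dt^2))$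 (an eigenvalue of $\bar A$) with multiplicity at least $n-1$. -/

import Mathlib

open scoped Manifold ContDiff Matrix

noncomputable section

/-! ### Riemannian geometry of hypersurfaces with metrics of low regularity

For a manifold `X` modelled on `E`, Mathlib identifies `TangentSpace I x` with `E` through the
preferred chart `extChartAt I x`; under this identification `mfderiv I I' F p` is the ordinary
derivative at `extChartAt I p p` of `writtenInExtChartAt I I' p F`, the map `F` read in the
preferred charts at `p` and at `F p`. All the local coordinate expressions below are taken in these
charts. All models are without boundary. -/

section General

variable {E : Type*} [NormedAddCommGroup E] [NormedSpace ℝ E]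
  {H : Type*} [TopologicalSpace H] (I : ModelWithCorners ℝ E H) [I.Boundaryless]
  {E' : Type*} [NormedAddCommGroup E'] [NormedSpace ℝ E']
  {H' : Type*} [TopologicalSpace H'] (I' : ModelWithCorners ℝ E' H') [I'.Boundaryless]

/-- A field of bilinear forms on the tangent spaces of `X`. The definitions below are applied to
`g + dt²`, to `φ⁻² (g + dt²)` and to `φ(·, ε)⁻² g`, which are Riemannian metrics. -/
abbrev TangentForm (X : Type*) [TopologicalSpace X] [ChartedSpace H X] :=
  ∀ x : X, TangentSpace I x →L[ℝ] TangentSpace I x →L[ℝ] ℝ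

variable {X : Type*} [TopologicalSpace X] [ChartedSpace H X]
  {M : Type*} [TopologicalSpace M] [ChartedSpace H' M]

/-- The value `h x`, with the tangent space written as the model space `E`. -/
def formAt (h : TangentForm I X) (x : X) : E →L[ℝ] E →L[ℝ] ℝ := h x

/-- The derivative of `F` at `p`, with the tangent spaces written as the model spaces. -/
def derivAt (F : M → X) (p : M) : E' →L[ℝ] E := mfderiv I' I F p

/-- The components of `h` in the chart at `x₀`, as a function on the model space `E`:
the pull-back of `h` under the inverse of the chart, `(h_{ab}(y))`. -/
def formInChart (h : TangentForm I X) (x₀ : X) (y : E) : E →L[ℝ] E →L[ℝ] ℝ :=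
  (formAt I h ((extChartAt I x₀).symm y)).bilinearComp
    (derivAt I 𝓘(ℝ, E) (extChartAt I x₀).symm y) (derivAt I 𝓘(ℝ, E) (extChartAt I x₀).symm y)

/-- The Christoffel symbols of the first kind of the Levi-Civita connection of `h`, at the centre
`x₀` of the chart at `x₀`: for constant fields `u, v, w` in that chart,
`h(∇_u v, w) = ½ (∂_u h(v, w) + ∂_v h(u, w) - ∂_w h(u, v))`. -/
def christoffel (h : TangentForm I X) (x₀ : X) (u v w : E) : ℝ :=
  (1 / 2) *
    (fderiv ℝ (formInChart I h x₀) (extChartAt I x₀ x₀) u v w +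
      fderiv ℝ (formInChart I h x₀) (extChartAt I x₀ x₀) v u w -
      fderiv ℝ (formInChart I h x₀) (extChartAt I x₀ x₀) w u v)

/-- The first fundamental form `h(F_* u, F_* v)` of a map `F : M → X`. -/
def firstFundamentalForm (h : TangentForm I X) (F : M → X) (p : M) (u v : E') : ℝ :=
  formAt I h (F p) (derivAt I I' F p u) (derivAt I I' F p v)

/-- The second fundamental form `h(∇_u (F_* v), ν)` of an immersion `F : M → X` at `p`, with respect
to the normal vector `ν`, where `∇` is the Levi-Civita connection of `h` and `v` is extended to a
constant field in the chart of `M` at `p`. In coordinates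
`∇_u (F_* v) = ∂_u ∂_v F + Γ(∂_u F, ∂_v F)`. -/
def secondFundamentalForm (h : TangentForm I X) (F : M → X) (p : M) (ν : E) (u v : E') : ℝ :=
  formAt I h (F p)
      (fderiv ℝ (fderiv ℝ (writtenInExtChartAt I' I p F)) (extChartAt I' p p) u v) ν +
    christoffel I h (F p) (derivAt I I' F p u) (derivAt I I' F p v) ν

/-- `ν` is a unit normal vector at `F p` to the immersion `F : M → X`, for the metric `h`. -/
def IsUnitNormalAt (h : TangentForm I X) (F : M → X) (p : M) (ν : TangentSpace I (F p)) : Prop :=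
  h (F p) ν ν = 1 ∧ ∀ v : TangentSpace I' p, h (F p) ν (mfderiv I' I F p v) = 0

/-- `F : M → X` is a `C²` immersion. -/
def IsC2Immersion (F : M → X) : Prop :=
  ContMDiff I' I 2 F ∧ ∀ p : M, Function.Injective (mfderiv I' I F p)

end General

section Hypersurface

variable {E : Type*} [NormedAddCommGroup E] [NormedSpace ℝ E]
  {H : Type*} [TopologicalSpace H] (I : ModelWithCorners ℝ E H) [I.Boundaryless]
  {X : Type*} [TopologicalSpace X] [ChartedSpace H X]
  {m : ℕ} {M : Type*} [TopologicalSpace M] [ChartedSpace (EuclideanSpace ℝ (Fin m)) M]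

/-- The coordinate vector `∂_i` of a chart. -/
def coordVector (i : Fin m) : EuclideanSpace ℝ (Fin m) := EuclideanSpace.single i 1

/-- The matrix `A^i_j = ∑_k h^{ik} h(ν, ∇_{e_k} e_j)` of the shape operator at `p` of the immersed
hypersurface `F : M → X` with respect to the normal vector `ν` and the metric `h`, in the
coordinate frame `e_i = F_* ∂_i`; here `(h^{ik})` is the inverse of the matrix of the induced
metric. -/
def shapeMatrix (h : TangentForm I X) (F : M → X) (p : M) (ν : TangentSpace I (F p)) :
    Matrix (Fin m) (Fin m) ℝ :=
  (Matrix.of fun i k ↦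
      firstFundamentalForm I (𝓡 m) h F p (coordVector i) (coordVector k))⁻¹ *
    Matrix.of fun k j ↦
      secondFundamentalForm I (𝓡 m) h F p ν (coordVector k) (coordVector j)

end Hypersurface

/-- The squared norm `|A|² = A^i_j A^j_i` of a shape operator `A` (which is self-adjoint for the
induced metric). -/
def shapeNormSq {m : ℕ} (A : Matrix (Fin m) (Fin m) ℝ) : ℝ := (A * A).trace

/-- The multiplicity of `κ` as a principal curvature of the shape operator `A`, i.e. the dimension
of the corresponding eigenspace (`0` if `κ` is not a principal curvature). -/
def principalMultiplicity {m : ℕ} (A : Matrix (Fin m) (Fin m) ℝ) (κ : ℝ) : ℕ :=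
  Module.finrank ℝ (Module.End.eigenspace (Matrix.toLin' A) κ)

/-- The shape operator `A` is umbilic with principal curvature `κ`. -/
def IsUmbilicWith {m : ℕ} (A : Matrix (Fin m) (Fin m) ℝ) (κ : ℝ) : Prop :=
  A = κ • (1 : Matrix (Fin m) (Fin m) ℝ)

section Product

variable {n : ℕ} {N : Type*} [TopologicalSpace N] [ChartedSpace (EuclideanSpace ℝ (Fin n)) N]

/-- The product metric `g + dt²` on `N × ℝ`. -/
def productMetric (g : TangentForm (𝓡 n) N) : TangentForm ((𝓡 n).prod 𝓘(ℝ, ℝ)) (N × ℝ) :=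
  fun z ↦
    let dπ : EuclideanSpace ℝ (Fin n) × ℝ →L[ℝ] EuclideanSpace ℝ (Fin n) :=
      derivAt (𝓡 n) ((𝓡 n).prod 𝓘(ℝ, ℝ)) Prod.fst z
    let dt : EuclideanSpace ℝ (Fin n) × ℝ →L[ℝ] ℝ :=
      derivAt 𝓘(ℝ, ℝ) ((𝓡 n).prod 𝓘(ℝ, ℝ)) Prod.snd z
    (formAt (𝓡 n) g z.1).bilinearComp dπ dπ + (ContinuousLinearMap.mul ℝ ℝ).bilinearComp dt dt

/-- The conformal metric `φ⁻² (g + dt²)` on `N × ℝ`. -/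
def conformalMetric (g : TangentForm (𝓡 n) N) (φ : N × ℝ → ℝ) :
    TangentForm ((𝓡 n).prod 𝓘(ℝ, ℝ)) (N × ℝ) :=
  fun z ↦ (φ z ^ 2)⁻¹ • productMetric g z

/-- The metric `φ(·, ε)⁻² g` on the slice `N × {ε}`, which is identified with `N`. -/
def sliceMetric (g : TangentForm (𝓡 n) N) (φ : N × ℝ → ℝ) (ε : ℝ) : TangentForm (𝓡 n) N :=
  fun x ↦ (φ (x, ε) ^ 2)⁻¹ • g x

/-- The vector `∂_t` at a point of `N × ℝ`. -/
def partialT (z : N × ℝ) : TangentSpace ((𝓡 n).prod 𝓘(ℝ, ℝ)) z :=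
  ((0, 1) : EuclideanSpace ℝ (Fin n) × ℝ)

/-- A vector tangent to `N`, regarded as a vector tangent to the slice `N × {t}` in `N × ℝ`. -/
def sliceVector (z : N × ℝ) (w : TangentSpace (𝓡 n) z.1) :
    TangentSpace ((𝓡 n).prod 𝓘(ℝ, ℝ)) z :=
  ((w, 0) : EuclideanSpace ℝ (Fin n) × ℝ)

/-- The derivative `φ_t = ∂φ/∂t`. -/
def derivT (φ : N × ℝ → ℝ) (z : N × ℝ) : ℝ := deriv (fun t ↦ φ (z.1, t)) z.2

end Product

/-- The level set `Σ = M ∩ {t = ε}` of a hypersurface `F : M → N × ℝ`, as a subset of `M`. -/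
def levelSet {N M : Type*} (F : M → N × ℝ) (ε : ℝ) : Set M := {p | (F p).2 = ε}

/-- The level set `Σ` as a hypersurface in the slice `N × {ε} ≅ N`. -/
def levelSetMap {N M : Type*} (F : M → N × ℝ) (ε : ℝ) : levelSet F ε → N := fun p ↦ (F p).1

/-- The level set `M ∩ {t = ε}` of the `n`-dimensional hypersurface `F : M → N × ℝ` is regular:
the differential of the height function `t ∘ F` does not vanish on it. -/
def IsRegularLevel (n : ℕ) {N M : Type*} [TopologicalSpace M]
    [ChartedSpace (EuclideanSpace ℝ (Fin n)) M] (F : M → N × ℝ) (ε : ℝ) : Prop :=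
  ∀ p ∈ levelSet F ε, mfderiv (𝓡 n) 𝓘(ℝ, ℝ) (fun q ↦ (F q).2) p ≠ 0

end

/-! Along `Σ` the horizontal part of `ν` is orthogonal to `TΣ`, so `ν = ⟨ν,η⟩ η + ⟨ν,∂_t⟩ ∂_t`. The
second fundamental form is linear in the normal. Its `η` part is the second fundamental form of `Σ`
in the slice. Its `∂_t` part is that of the slice `N × {ε}`, which is totally geodesic for `g + dt²`
and becomes umbilic with curvature `φ_t` after the conformal change. Hence on `TΣ` one has `II_M =
⟨ν,η⟩ II_Σ + ⟨ν,∂_t⟩ φ_t I` (`secondFundamentalForm_levelSet`), and the bracket `B` of the theorem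
is the trace of `II_M` over `TΣ`.

The rest is linear algebra at one point (`Matrix.PosDef.trace_inequality`). In a frame of `TM`
adapted to `Σ`, the shape operator consists of a block `C` on `TΣ`, a mixed part `w` and a normal
entry `d`, with `H = tr C + d`, `|A|² = tr C² + 2|w|² + d²` and `B = tr C`. The entry `d` cancels,
and the difference of the two sides is `½ (tr C² - B²/(n-1)) + |w|²`. Both terms are nonnegative,
the first by Cauchy–Schwarz, and they vanish exactly when `C` is scalar and `w = 0`. Since `⟨ν,η⟩ ≠
0` on a regular level, `C` is scalar if and only if `Σ` is umbilic. Once `C` is scalar, `w = 0`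
amounts to its eigenvalue having multiplicity at least `n-1` for `A`
(`Matrix.eq_zero_of_card_le_nullity`). -/

noncomputable section

/-! ### Linear algebra of a shape operator and a hyperplane -/

namespace Matrix

variable {ι κ : Type*} [Fintype ι] [Fintype κ] [DecidableEq ι] [DecidableEq κ]

open scoped MatrixOrder Matrix.Norms.L2Operator in
-- Writing `G⁻¹ = Rᵀ R` with `R` invertible turns the trace into the squared Frobenius norm of `R T
-- Rᵀ`. This is the positivity behind Cauchy–Schwarz for `G`-self-adjoint operators, together with
-- its equality case.
theorem PosDef.trace_inv_mul_mul_inv_mul_nonneg {G T : Matrix ι ι ℝ} (hG : G.PosDef)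
    (hT : Tᵀ = T) :
    0 ≤ (G⁻¹ * T * (G⁻¹ * T)).trace ∧ ((G⁻¹ * T * (G⁻¹ * T)).trace = 0 → T = 0) := by
  obtain ⟨R, hR, h⟩ : ∃ R : Matrix ι ι ℝ, IsUnit R ∧ G⁻¹ = Rᵀ * R := by
    obtain ⟨R, hR, h⟩ := CStarAlgebra.isStrictlyPositive_iff_eq_star_mul_self.mp
      hG.inv.isStrictlyPositive
    exact ⟨R, hR, by rw [h, star_eq_conjTranspose, conjTranspose_eq_transpose_of_trivial]⟩
  have key : (G⁻¹ * T * (G⁻¹ * T)).trace = ((R * T * Rᵀ)ᴴ * (R * T * Rᵀ)).trace := by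
    rw [h, conjTranspose_eq_transpose_of_trivial]
    simp only [transpose_mul, transpose_transpose, hT, Matrix.mul_assoc]
    rw [Matrix.trace_mul_comm]
    simp only [Matrix.mul_assoc]
  refine ⟨key ▸ (posSemidef_conjTranspose_mul_self _).trace_nonneg, fun h0 ↦ ?_⟩
  rw [key, trace_conjTranspose_mul_self_eq_zero_iff] at h0
  have hRt : IsUnit Rᵀ := (isUnit_transpose R).2 hR
  rwa [hRt.mul_left_eq_zero, hR.mul_right_eq_zero] at h0

omit [DecidableEq ι] [DecidableEq κ] in
/-- A unit vector orthogonal to the image of `L`, as a column matrix. -/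
theorem PosDef.exists_unit_normal {G : Matrix ι ι ℝ} (hG : G.PosDef) (L : Matrix ι κ ℝ)
    (hcard : Fintype.card κ < Fintype.card ι) :
    ∃ V : Matrix ι Unit ℝ, Vᵀ * G * L = 0 ∧ Vᵀ * G * V = 1 := by
  have hGt : Gᵀ = G := hG.isHermitian.eq
  have hker := LinearMap.ker_ne_bot_of_finrank_lt (f := (Lᵀ * G).mulVecLin) (by simpa using hcard)
  -- `Lᵀ G` has fewer rows than columns, so it kills some `x ≠ 0`; the normal is `x` divided by its
  -- `G`-length.
  obtain ⟨x, hx, hx0⟩ := (Submodule.ne_bot_iff _).1 hker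
  have hpos : 0 < x ⬝ᵥ G *ᵥ x := by simpa using hG.dotProduct_mulVec_pos hx0
  have hx' : (Lᵀ * G) * replicateCol Unit x = 0 := by
    rw [← replicateCol_mulVec]
    rw [LinearMap.mem_ker, mulVecLin_apply] at hx
    rw [hx]; rfl
  have hx2 : (replicateCol Unit x)ᵀ * G * replicateCol Unit x
      = (x ⬝ᵥ G *ᵥ x) • (1 : Matrix Unit Unit ℝ) := by
    rw [Matrix.mul_assoc, ← replicateCol_mulVec]
    ext i j
    simp [Matrix.mul_apply, dotProduct]
  refine ⟨(√(x ⬝ᵥ G *ᵥ x))⁻¹ • replicateCol Unit x, ?_, ?_⟩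
  · have := congrArg Matrix.transpose hx'
    simp only [transpose_mul, hGt, transpose_transpose, transpose_zero] at this
    rw [transpose_smul, Matrix.smul_mul, Matrix.smul_mul, Matrix.mul_assoc, this, smul_zero]
  · simp only [transpose_smul, Matrix.smul_mul, Matrix.mul_smul, hx2, smul_smul]
    rw [← mul_assoc, ← mul_inv, Real.mul_self_sqrt hpos.le, inv_mul_cancel₀ hpos.ne', one_smul]

/-- Completeness of an adapted frame: `G⁻¹` in terms of the frame `(L, V)`. -/
theorem PosDef.inv_eq_of_adapted {G : Matrix ι ι ℝ} (hG : G.PosDef) {L : Matrix ι κ ℝ}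
    (hcard : Fintype.card ι = Fintype.card κ + 1) (hL : Function.Injective L.mulVec)
    {V : Matrix ι Unit ℝ} (hVL : Vᵀ * G * L = 0) (hV : Vᵀ * G * V = 1) :
    G⁻¹ = L * (Lᵀ * G * L)⁻¹ * Lᵀ + V * Vᵀ := by
  have hGt : Gᵀ = G := hG.isHermitian.eq
  have hS : IsUnit (Lᵀ * G * L).det := by
    have := (hG.conjTranspose_mul_mul_same hL).isUnit
    rwa [conjTranspose_eq_transpose_of_trivial, isUnit_iff_isUnit_det] at this
  have hLV : Lᵀ * G * V = 0 := by
    have := congrArg Matrix.transpose hVL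
    simpa [transpose_mul, hGt, Matrix.mul_assoc] using this
  have hinj : Function.Injective (fromCols L V).mulVecLin := by
    rw [← LinearMap.ker_eq_bot, LinearMap.ker_eq_bot']
    intro x hx
    rw [mulVecLin_apply, ← Sum.elim_comp_inl_inr x, fromCols_mulVec_sumElim] at hx
    have h2 := congrArg ((Vᵀ * G) *ᵥ ·) hx
    simp only [mulVec_add, mulVec_mulVec, hVL, hV, zero_mulVec, one_mulVec, mulVec_zero,
      zero_add] at h2
    rw [h2, mulVec_zero, add_zero, ← mulVec_zero L] at hx
    have h1 := hL hx
    rw [← Sum.elim_comp_inl_inr x, h1, h2]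
    ext i; cases i <;> rfl
  have hsurj : Function.Surjective (fromCols L V).mulVecLin :=
    (LinearMap.injective_iff_surjective_of_finrank_eq_finrank (by simp [hcard])).1 hinj
  -- The columns of `L` and `V` span, so it is enough that the candidate times `G` fixes each of
  -- them.
  refine inv_eq_left_inv ?_
  have e1 : (L * (Lᵀ * G * L)⁻¹ * Lᵀ + V * Vᵀ) * G * L = L := by
    simp only [Matrix.add_mul, Matrix.mul_assoc]
    rw [← Matrix.mul_assoc Vᵀ, hVL, ← Matrix.mul_assoc Lᵀ, nonsing_inv_mul _ hS]
    simp
  have e2 : (L * (Lᵀ * G * L)⁻¹ * Lᵀ + V * Vᵀ) * G * V = V := by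
    simp only [Matrix.add_mul, Matrix.mul_assoc]
    rw [← Matrix.mul_assoc Vᵀ, hV, ← Matrix.mul_assoc Lᵀ _ V, hLV]
    simp
  have e3 : (L * (Lᵀ * G * L)⁻¹ * Lᵀ + V * Vᵀ) * G * fromCols L V = fromCols L V := by
    rw [mul_fromCols, e1, e2]
  refine ext_of_mulVec_single fun i ↦ ?_
  obtain ⟨y, hy⟩ := hsurj (Pi.single i 1)
  rw [mulVecLin_apply] at hy
  rw [← hy, mulVec_mulVec, e3, one_mulVec]

omit [DecidableEq ι] in
/-- An operator `T` with `T L = V wᵀ`, `T V = L z + c V` and `z = 0 → w = 0` has nullity less than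
the rank of `L` unless `w = 0`. -/
theorem eq_zero_of_card_le_nullity {T : Matrix ι ι ℝ} {L : Matrix ι κ ℝ} {V : Matrix ι Unit ℝ}
    {w z : Matrix κ Unit ℝ} {c : ℝ} (hcard : Fintype.card ι = Fintype.card κ + 1)
    (hL : Function.Injective L.mulVec) {P : Matrix Unit ι ℝ} (hPL : P * L = 0) (hPV : P * V = 1)
    (hTL : T * L = V * wᵀ) (hTV : T * V = L * z + c • V) (hzw : z = 0 → w = 0)
    (hnull : Fintype.card κ ≤ Module.finrank ℝ (LinearMap.ker T.mulVecLin)) : w = 0 := by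
  by_contra hw
  obtain ⟨k, hk⟩ : ∃ k, w k () ≠ 0 := by
    by_contra! h
    exact hw (by ext i j; exact h i)
  -- The nullity bound leaves rank at most one. A nonzero entry `w k` puts `V` in the range, which
  -- is then the line of `V`. So `T V` is a multiple of `V`, which forces `L z = 0` and, through
  -- `hzw`, `w = 0`.
  have hrank : Module.finrank ℝ (LinearMap.range T.mulVecLin) ≤ 1 := by
    have := LinearMap.finrank_range_add_finrank_ker T.mulVecLin
    rw [Module.finrank_fintype_fun_eq_card] at this
    omega
  have hmem : V.col () ∈ LinearMap.range T.mulVecLin := by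
    refine ⟨(w k ())⁻¹ • L *ᵥ Pi.single k 1, ?_⟩
    rw [mulVecLin_apply, mulVec_smul, mulVec_mulVec, hTL]
    ext i
    simp [Matrix.mul_apply]
    field_simp
  have hV0 : V.col () ≠ 0 := by
    intro h
    have : V = 0 := by ext i j; exact congrFun h i
    rw [this, Matrix.mul_zero] at hPV
    exact zero_ne_one hPV
  have hspan := finrank_le_one_iff.1 hrank
  obtain ⟨b, hb⟩ := hspan
  obtain ⟨s, hs⟩ := hb ⟨_, hmem⟩
  obtain ⟨t, ht⟩ := hb ⟨T *ᵥ V.col (), ⟨_, rfl⟩⟩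
  have hs' : s • (b : ι → ℝ) = V.col () := congrArg Subtype.val hs
  have ht' : t • (b : ι → ℝ) = T *ᵥ V.col () := congrArg Subtype.val ht
  have hs0 : s ≠ 0 := by rintro rfl; exact hV0 (by rw [← hs', zero_smul])
  have hTV' : T * V = (t * s⁻¹) • V := by
    have : T *ᵥ V.col () = (t * s⁻¹) • V.col () := by
      rw [← hs', smul_smul, mul_assoc, inv_mul_cancel₀ hs0, mul_one, ht', hs']
    ext i j
    exact congrFun this i
  have hc : t * s⁻¹ = c := by
    have h := congrArg (P * ·) (hTV'.symm.trans hTV)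
    simp only [Matrix.mul_smul, Matrix.mul_add, ← Matrix.mul_assoc, hPL, hPV,
      Matrix.zero_mul, zero_add] at h
    simpa using congrFun (congrFun h ()) ()
  rw [hTV', hc] at hTV
  have hLz : L * z = 0 := by simpa using hTV
  refine hw (hzw ?_)
  have : L *ᵥ z.col () = L *ᵥ 0 := by
    rw [mulVec_zero]; ext i; exact congrFun (congrFun hLz i) ()
  ext i j
  exact congrFun (hL this) i

/-- The algebraic inequality for a shape operator `A = G⁻¹ K` of a hypersurface restricted to a
submanifold of codimension one with tangent frame `L`, where the restriction of `K` is
`α • K' + β • Lᵀ G L`. -/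
theorem PosDef.trace_inequality {G K : Matrix ι ι ℝ} (hG : G.PosDef) (hK : Kᵀ = K)
    {L : Matrix ι κ ℝ} (hcard : Fintype.card ι = Fintype.card κ + 1)
    (hκ : 0 < Fintype.card κ)
    (hL : Function.Injective L.mulVec) {K' : Matrix κ κ ℝ} {α β : ℝ} (hα : α ≠ 0)
    (hres : Lᵀ * K * L = α • K' + β • (Lᵀ * G * L)) {A : Matrix ι ι ℝ} (hA : A = G⁻¹ * K)
    {A' : Matrix κ κ ℝ} (hA' : A' = (Lᵀ * G * L)⁻¹ * K') {B : ℝ}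
    (hB : B = α * A'.trace + Fintype.card κ * β) :
    A.trace * B ≥ (1 / 2) * (A.trace ^ 2 - (A * A).trace) +
        ((Fintype.card ι : ℝ) / (2 * Fintype.card κ)) * B ^ 2 ∧
    (A.trace * B = (1 / 2) * (A.trace ^ 2 - (A * A).trace) +
        ((Fintype.card ι : ℝ) / (2 * Fintype.card κ)) * B ^ 2 ↔
      ∃ c : ℝ, A' = c • (1 : Matrix κ κ ℝ) ∧ Fintype.card κ ≤
        Module.finrank ℝ (LinearMap.ker (A - (α * c + β) • (1 : Matrix ι ι ℝ)).mulVecLin)) := by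
  obtain ⟨V, hVL, hV⟩ := hG.exists_unit_normal L (by omega)
  have hinv := hG.inv_eq_of_adapted hcard hL hVL hV
  have hGt : Gᵀ = G := hG.isHermitian.eq
  have hS : (Lᵀ * G * L).PosDef := by
    simpa [conjTranspose_eq_transpose_of_trivial] using hG.conjTranspose_mul_mul_same hL
  set S := Lᵀ * G * L with hSdef
  have hSu : IsUnit S.det := (isUnit_iff_isUnit_det S).1 hS.isUnit
  have hSt : Sᵀ = S := hS.isHermitian.eq
  set J := Lᵀ * K * L with hJdef
  have hJt : Jᵀ = J := by simp [hJdef, transpose_mul, hK, Matrix.mul_assoc]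
  -- In the frame `(L, V)` the operator `A` has diagonal blocks `C` and `d` and off-diagonal blocks
  -- `wᵀ` and `S⁻¹ w`; the two latter correspond because `K` is symmetric.
  set C := S⁻¹ * J with hCdef
  set w := Lᵀ * K * V with hwdef
  have hwt : wᵀ = Vᵀ * K * L := by simp [hwdef, transpose_mul, hK, Matrix.mul_assoc]
  have hC : C = α • A' + β • 1 := by
    rw [hCdef, hres, hA', Matrix.mul_add, Matrix.mul_smul, Matrix.mul_smul,
      nonsing_inv_mul _ hSu]
  have hAL : A * L = L * C + V * wᵀ := by
    rw [hA, hinv, hwt, hCdef, hJdef]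
    simp only [Matrix.add_mul, Matrix.mul_assoc]
  set d := (Vᵀ * K * V).trace with hd
  have hVKV : Vᵀ * K * V = d • 1 := by
    ext i j
    simp [hd, trace]
  have hAV : A * V = L * (S⁻¹ * w) + d • V := by
    rw [← Matrix.mul_one V, ← Matrix.mul_smul V, ← hVKV, Matrix.mul_one, hA, hinv, hwdef]
    simp only [Matrix.add_mul, Matrix.mul_assoc]
  have htr : A.trace = C.trace + d := by
    rw [hA, hinv, Matrix.add_mul, trace_add, hCdef, hJdef, hd]
    congr 1
    · rw [Matrix.mul_assoc, Matrix.mul_assoc, Matrix.trace_mul_comm]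
      simp only [Matrix.mul_assoc]
    · rw [Matrix.mul_assoc, Matrix.trace_mul_comm]
  have htr2 : (A * A).trace = (C * C).trace + 2 * (wᵀ * S⁻¹ * w).trace + d ^ 2 := by
    have e : A * A = A * L * (S⁻¹ * Lᵀ * K) + A * V * (Vᵀ * K) := by
      nth_rewrite 2 [hA]
      rw [hinv]
      simp only [Matrix.add_mul, Matrix.mul_add, Matrix.mul_assoc]
    have c1 : (L * C * (S⁻¹ * Lᵀ * K)).trace = (C * C).trace := by
      rw [Matrix.mul_assoc, Matrix.trace_mul_comm, hCdef, hJdef]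
      simp only [Matrix.mul_assoc]
    have c2 : (V * wᵀ * (S⁻¹ * Lᵀ * K)).trace = (wᵀ * S⁻¹ * w).trace := by
      rw [Matrix.mul_assoc, Matrix.trace_mul_comm, hwdef]
      simp only [Matrix.mul_assoc]
    have c3 : (L * (S⁻¹ * w) * (Vᵀ * K)).trace = (wᵀ * S⁻¹ * w).trace := by
      rw [Matrix.mul_assoc, Matrix.trace_mul_comm, Matrix.mul_assoc, ← hwt,
        Matrix.trace_mul_comm, Matrix.mul_assoc]
    have c4 : (d • V * (Vᵀ * K)).trace = d ^ 2 := by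
      rw [Matrix.smul_mul, trace_smul, Matrix.trace_mul_comm, ← hd, smul_eq_mul, sq]
    rw [e, hAL, hAV, Matrix.add_mul, Matrix.add_mul, trace_add, trace_add, trace_add, c1, c2, c3,
      c4]
    ring
  have hCB : C.trace = B := by
    rw [hC, hB]
    simp [mul_comm]
  set k : ℝ := (Fintype.card κ : ℝ) with hk
  have hk0 : 0 < k := by simpa [hk] using hκ
  have hcι : (Fintype.card ι : ℝ) = k + 1 := by rw [hcard]; push_cast; rfl
  -- `B / k` is the mean eigenvalue of `C`, so `S⁻¹ T` is the trace-free part of `C`, whose square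
  -- has trace `tr C² - B²/k`.
  obtain ⟨hdev, hdev0⟩ := hS.trace_inv_mul_mul_inv_mul_nonneg (T := J - (B / k) • S)
    (by rw [transpose_sub, transpose_smul, hJt, hSt])
  have hdevC : S⁻¹ * (J - (B / k) • S) = C - (B / k) • 1 := by
    rw [Matrix.mul_sub, Matrix.mul_smul, nonsing_inv_mul _ hSu]
  have hdevtr : ((C - (B / k) • 1) * (C - (B / k) • 1)).trace = (C * C).trace - B ^ 2 / k := by
    simp only [Matrix.mul_sub, Matrix.sub_mul, Matrix.smul_mul, Matrix.mul_smul, Matrix.one_mul,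
      Matrix.mul_one, trace_sub, trace_smul, hCB, trace_one, ← hk, smul_eq_mul]
    field_simp
    ring
  rw [hdevC, hdevtr] at hdev hdev0
  have hwpos : 0 ≤ (wᵀ * S⁻¹ * w).trace := by
    have := (hS.inv.posSemidef.conjTranspose_mul_mul_same w).trace_nonneg
    simpa [conjTranspose_eq_transpose_of_trivial] using this
  have hw0 : (wᵀ * S⁻¹ * w).trace = 0 → w = 0 := by
    intro h
    by_contra hw
    have hcol : w.col () ≠ 0 := fun h ↦ hw (by ext i j; exact congrFun h i)
    have hpos := hS.inv.dotProduct_mulVec_pos hcol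
    refine hpos.ne' ?_
    rw [← h]
    simp [trace, Matrix.mul_apply, dotProduct, mulVec, Finset.mul_sum,
      Matrix.mul_assoc]
  -- The defect is a sum of two nonnegative terms; the normal entry `d` has dropped out.
  have hid : A.trace * B - ((1 / 2) * (A.trace ^ 2 - (A * A).trace) +
        ((Fintype.card ι : ℝ) / (2 * k)) * B ^ 2) =
      (1 / 2) * ((C * C).trace - B ^ 2 / k) + (wᵀ * S⁻¹ * w).trace := by
    rw [htr2, htr, hcι, hCB]
    field_simp
    ring
  refine ⟨by linarith, ⟨fun heq ↦ ?_, ?_⟩⟩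
  · have h1 : (C * C).trace - B ^ 2 / k = 0 := by linarith
    have h2 : w = 0 := hw0 (by linarith)
    have h3 : C = (B / k) • 1 := by
      rw [← sub_eq_zero, ← hdevC, hdev0 h1, Matrix.mul_zero]
    have hc : α * ((B / k - β) / α) + β = B / k := by field_simp; ring
    -- The witness solves `α c + β = B / k`, the eigenvalue of the scalar block `C`. The columns of
    -- `L` are then eigenvectors of `A`, since `w = 0`.
    refine ⟨(B / k - β) / α, ?_, ?_⟩
    · have h4 : α • A' = (B / k - β) • (1 : Matrix κ κ ℝ) := by
        rw [sub_smul, ← h3, hC, add_sub_cancel_right]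
      rw [div_eq_inv_mul, mul_smul, ← h4, smul_smul, inv_mul_cancel₀ hα, one_smul]
    · rw [hc]
      have hle : LinearMap.range L.mulVecLin ≤
          LinearMap.ker (A - (B / k) • (1 : Matrix ι ι ℝ)).mulVecLin := by
        rintro _ ⟨x, rfl⟩
        rw [LinearMap.mem_ker, mulVecLin_apply, mulVecLin_apply, mulVec_mulVec, Matrix.sub_mul,
          hAL, h3, h2]
        simp
      have := Submodule.finrank_mono hle
      rwa [LinearMap.finrank_range_of_inj hL, Module.finrank_fintype_fun_eq_card] at this
  · rintro ⟨c, hc, hnull⟩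
    have hCc : C = (α * c + β) • 1 := by rw [hC, hc, smul_smul, add_smul]
    have hw : w = 0 := by
      -- With `C` scalar, `A - (α c + β)` sends `L` to `V wᵀ` and `V` to `L S⁻¹ w` plus a multiple
      -- of `V`; `Vᵀ G` reads off the `V`-component.
      refine eq_zero_of_card_le_nullity (P := Vᵀ * G) (c := d - (α * c + β)) (z := S⁻¹ * w)
        hcard hL hVL hV ?_ ?_ ?_ hnull
      · rw [Matrix.sub_mul, hAL, hCc]; simp
      · rw [Matrix.sub_mul, hAV, sub_smul, Matrix.smul_mul, Matrix.one_mul, add_sub_assoc]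
      · intro h
        rw [← Matrix.one_mul w, ← mul_nonsing_inv _ hSu, Matrix.mul_assoc, h, Matrix.mul_zero]
    have hBc : B = k * (α * c + β) := by rw [← hCB, hCc]; simp [hk, mul_comm]
    have h1 : (C * C).trace - B ^ 2 / k = 0 := by
      rw [hCc, hBc]
      simp only [Matrix.smul_mul, Matrix.mul_smul, Matrix.one_mul, trace_smul, trace_one, ← hk,
        smul_eq_mul]
      field_simp
      ring
    rw [h1, hw] at hid
    simp only [transpose_zero, Matrix.zero_mul, trace_zero] at hid
    linarith

end Matrix

/-! ### Metrics, Christoffel symbols and fundamental forms in charts -/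

section Charts

open Filter Topology

variable {E : Type*} [NormedAddCommGroup E] [NormedSpace ℝ E]
  {H : Type*} [TopologicalSpace H] {I : ModelWithCorners ℝ E H} [I.Boundaryless]
  {E' : Type*} [NormedAddCommGroup E'] [NormedSpace ℝ E']
  {H' : Type*} [TopologicalSpace H'] {I' : ModelWithCorners ℝ E' H'} [I'.Boundaryless]
  {X : Type*} [TopologicalSpace X] [ChartedSpace H X]
  {M : Type*} [TopologicalSpace M] [ChartedSpace H' M]

omit [I.Boundaryless] in
theorem derivAt_eq_fderiv {F : M → X} {p : M} (hF : MDifferentiableAt I' I F p) :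
    derivAt I I' F p = fderiv ℝ (writtenInExtChartAt I' I p F) (extChartAt I' p p) := by
  have h : HasFDerivWithinAt (writtenInExtChartAt I' I p F) (derivAt I I' F p) (Set.range I')
    (extChartAt I' p p) := hF.hasMFDerivAt.2
  rw [I'.range_eq_univ, hasFDerivWithinAt_univ] at h
  exact h.fderiv.symm

omit [I.Boundaryless] in
theorem ContMDiffAt.contDiffAt_writtenInExtChartAt {F : M → X} {p : M} {k : WithTop ℕ∞}
    (hF : ContMDiffAt I' I k F p) :
    ContDiffAt ℝ k (writtenInExtChartAt I' I p F) (extChartAt I' p p) := by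
  have := (contMDiffAt_iff.1 hF).2
  rwa [I'.range_eq_univ, contDiffWithinAt_univ] at this

theorem mdifferentiableAt_extChartAt_symm [IsManifold I 1 X] (x₀ : X) {y : E}
    (hy : y ∈ (extChartAt I x₀).target) :
    MDifferentiableAt 𝓘(ℝ, E) I (extChartAt I x₀).symm y :=
  (mdifferentiableOn_extChartAt_symm y hy).mdifferentiableAt
    ((isOpen_extChartAt_target x₀).mem_nhds hy)

/-- The tangent space at `x₀` is identified with `E` through this very chart, so components of a
form at the centre are its values. -/
theorem derivAt_extChartAt_symm_center [IsManifold I 1 X] (x₀ : X) :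
    derivAt I 𝓘(ℝ, E) (extChartAt I x₀).symm (extChartAt I x₀ x₀) =
      ContinuousLinearMap.id ℝ E := by
  rw [derivAt_eq_fderiv (mdifferentiableAt_extChartAt_symm x₀ (mem_extChartAt_target x₀))]
  have : writtenInExtChartAt 𝓘(ℝ, E) I (extChartAt I x₀ x₀) (extChartAt I x₀).symm
      =ᶠ[𝓝 (extChartAt I x₀ x₀)] id := by
    filter_upwards [extChartAt_target_mem_nhds (I := I) x₀] with y hy
    simp only [writtenInExtChartAt, Function.comp_apply, extChartAt_to_inv,
      extChartAt_model_space_eq_id, PartialEquiv.refl_symm, PartialEquiv.refl_coe, id_eq]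
    exact (extChartAt I x₀).right_inv hy
  simp only [extChartAt_model_space_eq_id, PartialEquiv.refl_coe, id_eq]
  rw [this.fderiv_eq, fderiv_id]

theorem formInChart_center [IsManifold I 1 X] (h : TangentForm I X) (x₀ : X) :
    formInChart I h x₀ (extChartAt I x₀ x₀) = formAt I h x₀ := by
  rw [formInChart, derivAt_extChartAt_symm_center, extChartAt_to_inv]
  rfl

/-- The components of a Riemannian metric in a chart are differentiable. -/
theorem differentiableAt_formInChart [IsManifold I 1 X] [IsManifold I ∞ X]
    (g : Bundle.ContMDiffRiemannianMetric I ∞ E (fun x : X ↦ TangentSpace I x)) (x₀ : X) :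
    DifferentiableAt ℝ (formInChart I g.inner x₀) (extChartAt I x₀ x₀) := by
  have h1 := (contMDiffAt_hom_bundle _).1 (g.contMDiff x₀)
  have h2 := h1.2.contDiffAt_writtenInExtChartAt.differentiableAt (by simp)
  refine h2.congr_of_eventuallyEq ?_
  filter_upwards [extChartAt_target_mem_nhds (I := I) x₀] with y hy
  have hsrc : (extChartAt I x₀).symm y ∈ (chartAt H x₀).source := by
    rw [← extChartAt_source I]; exact (extChartAt I x₀).map_target hy
  -- The tangent bundle trivialisation at `x₀` is the derivative of the chart on its whole domain,
  -- so the bundle coordinates of `g` are its chart components.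
  have hD : derivAt I 𝓘(ℝ, E) (extChartAt I x₀).symm y =
      Bundle.Trivialization.symmL ℝ (trivializationAt E (TangentSpace I) x₀)
        ((extChartAt I x₀).symm y) := by
    rw [TangentBundle.symmL_trivializationAt hsrc, (extChartAt I x₀).right_inv hy,
      I.range_eq_univ, mfderivWithin_univ]
    rfl
  ext a b
  simp only [writtenInExtChartAt, Function.comp_apply, extChartAt_model_space_eq_id,
    PartialEquiv.refl_coe, id_eq]
  rw [inCoordinates_apply_eq₂ hsrc hsrc (Set.mem_univ _), formInChart, hD,
    ← Bundle.Trivialization.symmL_apply (R := ℝ) _ hsrc,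
    ← Bundle.Trivialization.symmL_apply (R := ℝ) _ hsrc]
  simp
  rfl

theorem fderiv_apply_apply {E F : Type*} [NormedAddCommGroup E] [NormedSpace ℝ E]
    [NormedAddCommGroup F] [NormedSpace ℝ F] {h : F → E →L[ℝ] E →L[ℝ] ℝ} {y : F}
    (hh : DifferentiableAt ℝ h y) (u : F) (v w : E) :
    fderiv ℝ h y u v w = fderiv ℝ (fun y ↦ h y v w) y u := by
  have h1 := (hh.hasFDerivAt.clm_apply (hasFDerivAt_const v y)).clm_apply (hasFDerivAt_const w y)
  rw [h1.fderiv]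
  simp

omit [I.Boundaryless] in
theorem christoffel_comm {h : TangentForm I X}
    (hsymm : ∀ x u v, formAt I h x u v = formAt I h x v u) (x₀ : X) (u v w : E) :
    christoffel I h x₀ u v w = christoffel I h x₀ v u w := by
  have hform (y : E) (c d : E) : formInChart I h x₀ y c d = formInChart I h x₀ y d c :=
    hsymm _ _ _
  have h1 : fderiv ℝ (formInChart I h x₀) (extChartAt I x₀ x₀) w v u =
      fderiv ℝ (formInChart I h x₀) (extChartAt I x₀ x₀) w u v := by
    by_cases hd : DifferentiableAt ℝ (formInChart I h x₀) (extChartAt I x₀ x₀)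
    · rw [fderiv_apply_apply hd, fderiv_apply_apply hd]
      simp only [hform _ v u]
    -- Without differentiability `fderiv` takes the default value `0`, which is symmetric too.
    · rw [fderiv_zero_of_not_differentiableAt hd]; rfl
  rw [christoffel, christoffel, h1]
  ring

/-- The first fundamental form as a bilinear form. -/
def firstForm (h : TangentForm I X) (F : M → X) (p : M) : LinearMap.BilinForm ℝ E' :=
  LinearMap.mk₂ ℝ (firstFundamentalForm I I' h F p)
    (by intros; simp [firstFundamentalForm]) (by intros; simp [firstFundamentalForm])
    (by intros; simp [firstFundamentalForm]) (by intros; simp [firstFundamentalForm])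

/-- The second fundamental form as a bilinear form. -/
def secondForm (h : TangentForm I X) (F : M → X) (p : M) (ν : E) : LinearMap.BilinForm ℝ E' :=
  LinearMap.mk₂ ℝ (secondFundamentalForm I I' h F p ν)
    (by intros; simp [secondFundamentalForm, christoffel]; ring)
    (by intros; simp [secondFundamentalForm, christoffel]; ring)
    (by intros; simp [secondFundamentalForm, christoffel]; ring)
    (by intros; simp [secondFundamentalForm, christoffel]; ring)

omit [I.Boundaryless] in
theorem secondFundamentalForm_comm {h : TangentForm I X}
    (hsymm : ∀ x u v, formAt I h x u v = formAt I h x v u) {F : M → X} {p : M}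
    (hF : ContMDiffAt I' I 2 F p) (ν : E) (u v : E') :
    secondFundamentalForm I I' h F p ν u v = secondFundamentalForm I I' h F p ν v u := by
  have := (hF.contDiffAt_writtenInExtChartAt.isSymmSndFDerivAt (by simp)).eq u v
  rw [secondFundamentalForm, secondFundamentalForm, this, christoffel_comm hsymm]

end Charts

/-! ### The product and conformal metrics in product charts -/

section Product

open Filter Topology

variable {n : ℕ} {N : Type*} [TopologicalSpace N] [ChartedSpace (EuclideanSpace ℝ (Fin n)) N]

theorem formAt_productMetric (g : TangentForm (𝓡 n) N) (z : N × ℝ)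
    (a b : EuclideanSpace ℝ (Fin n) × ℝ) :
    formAt ((𝓡 n).prod 𝓘(ℝ, ℝ)) (productMetric g) z a b =
      formAt (𝓡 n) g z.1 a.1 b.1 + a.2 * b.2 := by
  simp only [formAt, productMetric, derivAt]
  rw [mfderiv_fst, mfderiv_snd]
  rfl

theorem extChartAt_prod_real_symm (z : N × ℝ) :
    ((extChartAt ((𝓡 n).prod 𝓘(ℝ, ℝ)) z).symm : EuclideanSpace ℝ (Fin n) × ℝ → N × ℝ) =
      Prod.map (extChartAt (𝓡 n) z.1).symm id := by
  rw [extChartAt_prod]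
  rfl

theorem extChartAt_prod_real (z w : N × ℝ) :
    extChartAt ((𝓡 n).prod 𝓘(ℝ, ℝ)) z w = (extChartAt (𝓡 n) z.1 w.1, w.2) := by
  rw [extChartAt_prod]
  rfl

theorem derivAt_extChartAt_prod_real_symm [IsManifold (𝓡 n) 1 N] (z : N × ℝ)
    {y : EuclideanSpace ℝ (Fin n) × ℝ} (hy : y.1 ∈ (extChartAt (𝓡 n) z.1).target)
    (a : EuclideanSpace ℝ (Fin n) × ℝ) :
    derivAt ((𝓡 n).prod 𝓘(ℝ, ℝ)) 𝓘(ℝ, EuclideanSpace ℝ (Fin n) × ℝ)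
      (extChartAt ((𝓡 n).prod 𝓘(ℝ, ℝ)) z).symm y a =
      (derivAt (𝓡 n) 𝓘(ℝ, EuclideanSpace ℝ (Fin n)) (extChartAt (𝓡 n) z.1).symm y.1 a.1, a.2) := by
  rw [extChartAt_prod_real_symm, derivAt, modelWithCornersSelf_prod, ← chartedSpaceSelf_prod,
    mfderiv_prodMap (mdifferentiableAt_extChartAt_symm z.1 hy) mdifferentiableAt_id, mfderiv_id]
  rfl

theorem formInChart_conformalMetric [IsManifold (𝓡 n) 1 N] (g : TangentForm (𝓡 n) N)
    (φ : N × ℝ → ℝ) (z : N × ℝ)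
    {y : EuclideanSpace ℝ (Fin n) × ℝ} (hy : y.1 ∈ (extChartAt (𝓡 n) z.1).target)
    (a b : EuclideanSpace ℝ (Fin n) × ℝ) :
    formInChart ((𝓡 n).prod 𝓘(ℝ, ℝ)) (conformalMetric g φ) z y a b =
      (φ ((extChartAt (𝓡 n) z.1).symm y.1, y.2) ^ 2)⁻¹ *
        (formInChart (𝓡 n) g z.1 y.1 a.1 b.1 + a.2 * b.2) := by
  have h1 (w : N × ℝ) (c d : EuclideanSpace ℝ (Fin n) × ℝ) :
      formAt ((𝓡 n).prod 𝓘(ℝ, ℝ)) (conformalMetric g φ) w c d =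
      (φ w ^ 2)⁻¹ * (formAt (𝓡 n) g w.1 c.1 d.1 + c.2 * d.2) := by
    rw [← formAt_productMetric]; rfl
  rw [formInChart, ContinuousLinearMap.bilinearComp_apply, h1,
    derivAt_extChartAt_prod_real_symm z hy, derivAt_extChartAt_prod_real_symm z hy,
    extChartAt_prod_real_symm]
  rfl

theorem formInChart_sliceMetric (g : TangentForm (𝓡 n) N)
    (φ : N × ℝ → ℝ) (ε : ℝ) (x : N) (y a b : EuclideanSpace ℝ (Fin n)) :
    formInChart (𝓡 n) (sliceMetric g φ ε) x y a b =
      (φ ((extChartAt (𝓡 n) x).symm y, ε) ^ 2)⁻¹ * formInChart (𝓡 n) g x y a b := rfl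

end Product

/-! ### Christoffel symbols of the conformal metric -/

theorem DifferentiableAt.real_smul {P F : Type*} [NormedAddCommGroup P] [NormedSpace ℝ P]
    [NormedAddCommGroup F] [NormedSpace ℝ F] {ψ : P → ℝ} {h : P → F} {y : P}
    (hψ : DifferentiableAt ℝ ψ y) (hh : DifferentiableAt ℝ h y) :
    DifferentiableAt ℝ (fun x ↦ ψ x • h x) y :=
  hψ.fun_smul hh

theorem DifferentiableAt.smul_add_const {P F : Type*} [NormedAddCommGroup P] [NormedSpace ℝ P]
    [NormedAddCommGroup F] [NormedSpace ℝ F] {ψ : P → ℝ} {h : P → F} {y : P}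
    (hψ : DifferentiableAt ℝ ψ y) (hh : DifferentiableAt ℝ h y) (c : F) :
    DifferentiableAt ℝ (fun x ↦ ψ x • (h x + c)) y :=
  hψ.fun_smul (hh.add_const c)

theorem DifferentiableAt.bilinearComp_self {P E E' : Type*} [NormedAddCommGroup P] [NormedSpace ℝ P]
    [NormedAddCommGroup E] [NormedSpace ℝ E] [NormedAddCommGroup E'] [NormedSpace ℝ E']
    {h : P → E →L[ℝ] E →L[ℝ] ℝ} {y : P} (hh : DifferentiableAt ℝ h y) (π : E' →L[ℝ] E) :
    DifferentiableAt ℝ (fun x ↦ (h x).bilinearComp π π) y := by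
  have h1 : DifferentiableAt ℝ (fun x ↦ (h x).comp π) y := hh.clm_comp (differentiableAt_const π)
  exact (differentiableAt_const ((ContinuousLinearMap.compL ℝ E' E ℝ).flip π)).clm_comp h1

section ConformalChristoffel

open Filter Topology

variable {n : ℕ} {N : Type*} [TopologicalSpace N] [ChartedSpace (EuclideanSpace ℝ (Fin n)) N]
  [IsManifold (𝓡 n) 1 N] [IsManifold (𝓡 n) ∞ N]
  (g : Bundle.ContMDiffRiemannianMetric (𝓡 n) ∞ (EuclideanSpace ℝ (Fin n))
      (fun x : N ↦ TangentSpace (𝓡 n) x))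
  {φ : N × ℝ → ℝ} (hφ : ContMDiff ((𝓡 n).prod 𝓘(ℝ, ℝ)) 𝓘(ℝ, ℝ) 1 φ) (hφ_pos : ∀ z, 0 < φ z)

omit [IsManifold (𝓡 n) 1 N] [IsManifold (𝓡 n) ∞ N] in
include hφ in
theorem differentiableAt_comp_extChartAt_symm (z : N × ℝ) :
    DifferentiableAt ℝ (fun y : EuclideanSpace ℝ (Fin n) × ℝ ↦
      φ ((extChartAt (𝓡 n) z.1).symm y.1, y.2)) (extChartAt (𝓡 n) z.1 z.1, z.2) := by
  have h := ((hφ z).contDiffAt_writtenInExtChartAt).differentiableAt one_ne_zero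
  rw [extChartAt_prod_real] at h
  simp only [writtenInExtChartAt, extChartAt_model_space_eq_id, extChartAt_prod_real_symm] at h
  exact h

omit [IsManifold (𝓡 n) 1 N] [IsManifold (𝓡 n) ∞ N] in
include hφ hφ_pos in
theorem differentiableAt_inv_sq (z : N × ℝ) :
    DifferentiableAt ℝ (fun y : EuclideanSpace ℝ (Fin n) × ℝ ↦
      (φ ((extChartAt (𝓡 n) z.1).symm y.1, y.2) ^ 2)⁻¹) (extChartAt (𝓡 n) z.1 z.1, z.2) :=
  ((differentiableAt_comp_extChartAt_symm hφ z).pow 2).inv (pow_ne_zero 2 (hφ_pos _).ne')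

include hφ hφ_pos in
theorem differentiableAt_formInChart_sliceMetric (z : N × ℝ) :
    DifferentiableAt ℝ (formInChart (𝓡 n) (sliceMetric g.inner φ z.2) z.1)
      (extChartAt (𝓡 n) z.1 z.1) := by
  have h0 : DifferentiableAt ℝ (fun y : EuclideanSpace ℝ (Fin n) ↦ (y, z.2))
      (extChartAt (𝓡 n) z.1 z.1) := differentiableAt_id.prodMk (differentiableAt_const z.2)
  have h1 := (differentiableAt_inv_sq hφ hφ_pos z).comp (extChartAt (𝓡 n) z.1 z.1) h0
  refine (DifferentiableAt.real_smul
    (F := EuclideanSpace ℝ (Fin n) →L[ℝ] EuclideanSpace ℝ (Fin n) →L[ℝ] ℝ) h1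
    (differentiableAt_formInChart g z.1)).congr_of_eventuallyEq (Eventually.of_forall fun y ↦ ?_)
  refine ContinuousLinearMap.ext fun a ↦ ContinuousLinearMap.ext fun b ↦ ?_
  exact formInChart_sliceMetric g.inner φ z.2 z.1 y a b

include hφ hφ_pos in
theorem differentiableAt_formInChart_conformalMetric (z : N × ℝ) :
    DifferentiableAt ℝ (formInChart ((𝓡 n).prod 𝓘(ℝ, ℝ)) (conformalMetric g.inner φ) z)
      (extChartAt (𝓡 n) z.1 z.1, z.2) := by
  let π : EuclideanSpace ℝ (Fin n) × ℝ →L[ℝ] EuclideanSpace ℝ (Fin n) := ContinuousLinearMap.fst ℝ (EuclideanSpace ℝ (Fin n)) ℝ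
  have hg : DifferentiableAt ℝ (fun y : EuclideanSpace ℝ (Fin n) × ℝ ↦ formInChart (𝓡 n) g.inner z.1 y.1)
      (extChartAt (𝓡 n) z.1 z.1, z.2) :=
    DifferentiableAt.comp (𝕜 := ℝ) (E := EuclideanSpace ℝ (Fin n) × ℝ)
      (F := EuclideanSpace ℝ (Fin n))
      (G := EuclideanSpace ℝ (Fin n) →L[ℝ] EuclideanSpace ℝ (Fin n) →L[ℝ] ℝ)
      (g := formInChart (𝓡 n) g.inner z.1) (f := Prod.fst)
      (extChartAt (𝓡 n) z.1 z.1, z.2) (differentiableAt_formInChart g z.1) differentiableAt_fst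
  let P := EuclideanSpace ℝ (Fin n) × ℝ
  refine (DifferentiableAt.smul_add_const (F := P →L[ℝ] P →L[ℝ] ℝ)
    (differentiableAt_inv_sq hφ hφ_pos z) (hg.bilinearComp_self π)
    ((ContinuousLinearMap.mul ℝ ℝ).bilinearComp (ContinuousLinearMap.snd ℝ _ ℝ)
      (ContinuousLinearMap.snd ℝ _ ℝ))).congr_of_eventuallyEq ?_
  filter_upwards [continuousAt_fst.preimage_mem_nhds
    (extChartAt_target_mem_nhds (I := 𝓡 n) z.1)] with y hy
  refine ContinuousLinearMap.ext fun a ↦ ContinuousLinearMap.ext fun b ↦ ?_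
  rw [formInChart_conformalMetric g.inner φ z hy]
  rfl

include hφ hφ_pos in
/-- The derivative of the components of the conformal metric, in terms of those of the slice. -/
theorem fderiv_formInChart_conformalMetric (z : N × ℝ) (u v w : EuclideanSpace ℝ (Fin n))
    (τ r : ℝ) :
    fderiv ℝ (formInChart ((𝓡 n).prod 𝓘(ℝ, ℝ)) (conformalMetric g.inner φ) z)
      (extChartAt (𝓡 n) z.1 z.1, z.2) (u, τ) (v, 0) (w, r) =
    fderiv ℝ (formInChart (𝓡 n) (sliceMetric g.inner φ z.2) z.1) (extChartAt (𝓡 n) z.1 z.1) u v w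
      - 2 * τ * derivT φ z / φ z * formAt (𝓡 n) (sliceMetric g.inner φ z.2) z.1 v w := by
  have hC := differentiableAt_formInChart_conformalMetric g hφ hφ_pos z
  rw [fderiv_apply_apply hC,
    fderiv_apply_apply (differentiableAt_formInChart_sliceMetric g hφ hφ_pos z)]
  set y₀ := extChartAt (𝓡 n) z.1 z.1 with hy₀
  set f : EuclideanSpace ℝ (Fin n) × ℝ → ℝ := fun y ↦
    formInChart ((𝓡 n).prod 𝓘(ℝ, ℝ)) (conformalMetric g.inner φ) z y (v, 0) (w, r) with hf
  have hfd : DifferentiableAt ℝ f (y₀, z.2) :=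
    (hC.clm_apply (differentiableAt_const _)).clm_apply (differentiableAt_const _)
  -- The vector `(v, 0)` is horizontal, so `dt²` contributes nothing, whatever `r` is.
  have hfv (y : EuclideanSpace ℝ (Fin n)) (hy : y ∈ (extChartAt (𝓡 n) z.1).target) (t : ℝ) :
      f (y, t) = (φ ((extChartAt (𝓡 n) z.1).symm y, t) ^ 2)⁻¹ *
        formInChart (𝓡 n) g.inner z.1 y v w := by
    rw [hf]
    simp only
    rw [formInChart_conformalMetric g.inner φ z hy]
    simp
  have hs : (fun y ↦ formInChart (𝓡 n) (sliceMetric g.inner φ z.2) z.1 y v w) =ᶠ[𝓝 y₀]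
      fun y ↦ f (y, z.2) := by
    filter_upwards [extChartAt_target_mem_nhds (I := 𝓡 n) z.1] with y hy
    rw [hfv y hy, formInChart_sliceMetric]
  have h1 : HasFDerivAt (fun y ↦ f (y, z.2)) ((fderiv ℝ f (y₀, z.2)).comp
      ((ContinuousLinearMap.id ℝ _).prod 0)) y₀ :=
    HasFDerivAt.comp (g := f) y₀ hfd.hasFDerivAt ((hasFDerivAt_id y₀).prodMk
      (hasFDerivAt_const z.2 y₀))
  have h2 : HasDerivAt (fun t ↦ f (y₀, t)) (fderiv ℝ f (y₀, z.2) (0, 1)) z.2 :=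
    HasFDerivAt.comp_hasDerivAt (l := f) z.2 hfd.hasFDerivAt
      ((hasDerivAt_const z.2 y₀).prodMk (hasDerivAt_id z.2))
  have hφd : HasDerivAt (fun t ↦ φ (z.1, t)) (derivT φ z) z.2 := by
    have h3 := (differentiableAt_comp_extChartAt_symm hφ z).comp z.2
      ((differentiableAt_const y₀).prodMk differentiableAt_id)
    have h4 : DifferentiableAt ℝ (fun t ↦ φ (z.1, t)) z.2 := by
      refine h3.congr_of_eventuallyEq (Eventually.of_forall fun t ↦ ?_)
      simp
    exact h4.hasDerivAt
  -- Only `φ⁻²` depends on `t`; its derivative is `-2 φ_t / φ` times itself.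
  have h5 : HasDerivAt (fun t ↦ f (y₀, t))
      (-(2 * φ z * derivT φ z) / (φ z ^ 2) ^ 2 * formAt (𝓡 n) g.inner z.1 v w) z.2 := by
    have h6 := ((hφd.pow 2).inv (pow_ne_zero 2 (hφ_pos _).ne')).mul_const
      (formAt (𝓡 n) g.inner z.1 v w)
    convert! h6 using 1
    · funext t
      rw [hfv y₀ (mem_extChartAt_target z.1), hy₀, extChartAt_to_inv, formInChart_center]
      rfl
    · simp
  have h7 := h2.unique h5
  rw [hs.fderiv_eq, h1.fderiv]
  have hsplit : ((u, τ) : EuclideanSpace ℝ (Fin n) × ℝ) = (u, 0) + τ • (0, 1) := by simp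
  have h8 : formAt (𝓡 n) (sliceMetric g.inner φ z.2) z.1 v w =
      (φ z ^ 2)⁻¹ * formAt (𝓡 n) g.inner z.1 v w := rfl
  rw [hsplit, map_add, map_smul, h7, h8]
  have := (hφ_pos z).ne'
  simp only [ContinuousLinearMap.comp_apply, ContinuousLinearMap.prod_apply,
    ContinuousLinearMap.id_apply, _root_.zero_apply, smul_eq_mul]
  field_simp
  ring

include hφ hφ_pos in
/-- The Christoffel symbols of the conformal metric on vectors tangent to a slice. -/
theorem christoffel_conformalMetric (z : N × ℝ) (a b c : EuclideanSpace ℝ (Fin n)) (s : ℝ) :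
    christoffel ((𝓡 n).prod 𝓘(ℝ, ℝ)) (conformalMetric g.inner φ) z (a, 0) (b, 0) (c, s) =
      christoffel (𝓡 n) (sliceMetric g.inner φ z.2) z.1 a b c +
        s * derivT φ z / φ z * formAt (𝓡 n) (sliceMetric g.inner φ z.2) z.1 a b := by
  -- The first two derivatives are in horizontal directions and give slice terms only. The third,
  -- along `(c, s)`, adds `-½ · (-2 s φ_t / φ)` times the slice metric: this is the umbilicity of
  -- the slice.
  rw [christoffel, christoffel, extChartAt_prod_real,
    fderiv_formInChart_conformalMetric g hφ hφ_pos, fderiv_formInChart_conformalMetric g hφ hφ_pos,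
    fderiv_formInChart_conformalMetric g hφ hφ_pos]
  ring

end ConformalChristoffel

/-! ### First and second derivatives along the level set -/

open Filter Topology in
/-- The second derivative of a composition. -/
theorem fderiv_fderiv_comp {E₁ E₂ E₃ : Type*} [NormedAddCommGroup E₁] [NormedSpace ℝ E₁]
    [NormedAddCommGroup E₂] [NormedSpace ℝ E₂] [NormedAddCommGroup E₃] [NormedSpace ℝ E₃]
    {G : E₂ → E₃} {f : E₁ → E₂} {x : E₁} (hG : ContDiffAt ℝ 2 G (f x)) (hf : ContDiffAt ℝ 2 f x)
    (u v : E₁) :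
    fderiv ℝ (fderiv ℝ (G ∘ f)) x u v =
      fderiv ℝ (fderiv ℝ G) (f x) (fderiv ℝ f x u) (fderiv ℝ f x v) +
        fderiv ℝ G (f x) (fderiv ℝ (fderiv ℝ f) x u v) := by
  have hG' : ∀ᶠ y in 𝓝 (f x), ContDiffAt ℝ 2 G y := hG.eventually (by simp)
  have hf' : ∀ᶠ y in 𝓝 x, ContDiffAt ℝ 2 f y := hf.eventually (by simp)
  have hev : fderiv ℝ (G ∘ f) =ᶠ[𝓝 x] fun y ↦ (fderiv ℝ G (f y)).comp (fderiv ℝ f y) := by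
    filter_upwards [hf.continuousAt.eventually hG', hf'] with y h1 h2
    exact fderiv_comp y (h1.differentiableAt two_ne_zero) (h2.differentiableAt two_ne_zero)
  have hdG : DifferentiableAt ℝ (fderiv ℝ G) (f x) :=
    (hG.fderiv_right (m := 1) (by norm_num)).differentiableAt one_ne_zero
  have hdf : DifferentiableAt ℝ (fderiv ℝ f) x :=
    (hf.fderiv_right (m := 1) (by norm_num)).differentiableAt one_ne_zero
  have h1 : HasFDerivAt (fun y ↦ fderiv ℝ G (f y))
      ((fderiv ℝ (fderiv ℝ G) (f x)).comp (fderiv ℝ f x)) x :=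
    HasFDerivAt.comp (g := fderiv ℝ G) x hdG.hasFDerivAt
      (hf.differentiableAt two_ne_zero).hasFDerivAt
  rw [hev.fderiv_eq, (h1.clm_comp hdf.hasFDerivAt).fderiv]
  simp [add_comm]

section LevelSet

open Filter Topology

variable {n m : ℕ} {N : Type*} [TopologicalSpace N] [ChartedSpace (EuclideanSpace ℝ (Fin n)) N]
  {M : Type*} [TopologicalSpace M] [ChartedSpace (EuclideanSpace ℝ (Fin n)) M]
  {F : M → N × ℝ} {ε : ℝ} [ChartedSpace (EuclideanSpace ℝ (Fin m)) (levelSet F ε)]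

theorem contMDiff_levelSetMap (hF : ContMDiff (𝓡 n) ((𝓡 n).prod 𝓘(ℝ, ℝ)) 2 F)
    (hS : ContMDiff (𝓡 m) (𝓡 n) 2 (Subtype.val : levelSet F ε → M)) :
    ContMDiff (𝓡 m) (𝓡 n) 2 (levelSetMap F ε) :=
  contMDiff_fst.comp (hF.comp hS)

/-- The level set in the preferred charts. -/
theorem written_comp_eventuallyEq
    (hS : ContMDiff (𝓡 m) (𝓡 n) 2 (Subtype.val : levelSet F ε → M)) (p : levelSet F ε) :
    writtenInExtChartAt (𝓡 n) ((𝓡 n).prod 𝓘(ℝ, ℝ)) (p : M) F ∘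
        writtenInExtChartAt (𝓡 m) (𝓡 n) p (Subtype.val : levelSet F ε → M)
      =ᶠ[𝓝 (extChartAt (𝓡 m) p p)]
      fun x ↦ (writtenInExtChartAt (𝓡 m) (𝓡 n) p (levelSetMap F ε) x, ε) := by
  have h := writtenInExtChartAt_comp (I := 𝓡 m) (I' := 𝓡 n) (I'' := (𝓡 n).prod 𝓘(ℝ, ℝ)) (g := F)
    (s := Set.univ) (hS p).continuousAt.continuousWithinAt
  rw [Set.preimage_univ, Set.univ_inter, (𝓡 m).range_eq_univ, nhdsWithin_univ] at h
  filter_upwards [h] with x hx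
  rw [← hx]
  simp only [writtenInExtChartAt, Function.comp_apply, extChartAt_prod_real]
  exact Prod.ext rfl ((extChartAt (𝓡 m) p).symm x).2

variable (hF : ContMDiff (𝓡 n) ((𝓡 n).prod 𝓘(ℝ, ℝ)) 2 F)
  (hS : ContMDiff (𝓡 m) (𝓡 n) 2 (Subtype.val : levelSet F ε → M)) (p : levelSet F ε)

include hF hS in
-- The height is constant on `Σ`, so differentiating `F ∘ ι = (levelSetMap, ε)`, with `ι` the
-- inclusion, gives horizontal vectors.
theorem derivAt_levelSet (u : EuclideanSpace ℝ (Fin m)) :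
    derivAt ((𝓡 n).prod 𝓘(ℝ, ℝ)) (𝓡 n) F p (derivAt (𝓡 n) (𝓡 m) Subtype.val p u) =
      (derivAt (𝓡 n) (𝓡 m) (levelSetMap F ε) p u, 0) := by
  have hσ := contMDiff_levelSetMap hF hS
  rw [derivAt_eq_fderiv ((hF p).mdifferentiableAt two_ne_zero),
    derivAt_eq_fderiv ((hS p).mdifferentiableAt two_ne_zero),
    derivAt_eq_fderiv ((hσ p).mdifferentiableAt two_ne_zero)]
  have h := (written_comp_eventuallyEq hS p).fderiv_eq (𝕜 := ℝ)
  have hs := (hσ p).contDiffAt_writtenInExtChartAt.differentiableAt two_ne_zero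
  have hF' := (hF p).contDiffAt_writtenInExtChartAt.differentiableAt two_ne_zero
  have hS' := (hS p).contDiffAt_writtenInExtChartAt.differentiableAt two_ne_zero
  have hc : writtenInExtChartAt (𝓡 m) (𝓡 n) p (Subtype.val : levelSet F ε → M)
      (extChartAt (𝓡 m) p p) = extChartAt (𝓡 n) (p : M) p := by
    simp [writtenInExtChartAt]
  rw [fderiv_comp _ (by rw [hc]; exact hF') hS', hc,
    (hs.hasFDerivAt.prodMk (hasFDerivAt_const ε _)).fderiv] at h
  exact DFunLike.congr_fun h u

include hF hS in
-- This is the second derivative of `F ∘ ι = (levelSetMap, ε)`. The correction from the second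
-- derivative of `ι` lies in the image of `dF`, so it is invisible to a normal of `M`.
theorem fderiv_fderiv_levelSet (u v : EuclideanSpace ℝ (Fin m)) :
    fderiv ℝ (fderiv ℝ (writtenInExtChartAt (𝓡 n) ((𝓡 n).prod 𝓘(ℝ, ℝ)) (p : M) F))
        (extChartAt (𝓡 n) (p : M) p) (derivAt (𝓡 n) (𝓡 m) Subtype.val p u)
        (derivAt (𝓡 n) (𝓡 m) Subtype.val p v) +
      derivAt ((𝓡 n).prod 𝓘(ℝ, ℝ)) (𝓡 n) F p (fderiv ℝ (fderiv ℝ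
        (writtenInExtChartAt (𝓡 m) (𝓡 n) p (Subtype.val : levelSet F ε → M)))
        (extChartAt (𝓡 m) p p) u v) =
      (fderiv ℝ (fderiv ℝ (writtenInExtChartAt (𝓡 m) (𝓡 n) p (levelSetMap F ε)))
        (extChartAt (𝓡 m) p p) u v, 0) := by
  have hσ := contMDiff_levelSetMap hF hS
  rw [derivAt_eq_fderiv ((hF p).mdifferentiableAt two_ne_zero),
    derivAt_eq_fderiv ((hS p).mdifferentiableAt two_ne_zero)]
  have hs := (hσ p).contDiffAt_writtenInExtChartAt
  have hF' := (hF p).contDiffAt_writtenInExtChartAt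
  have hS' := (hS p).contDiffAt_writtenInExtChartAt
  have hc : writtenInExtChartAt (𝓡 m) (𝓡 n) p (Subtype.val : levelSet F ε → M)
      (extChartAt (𝓡 m) p p) = extChartAt (𝓡 n) (p : M) p := by
    simp [writtenInExtChartAt]
  rw [← hc, ← fderiv_fderiv_comp (by rw [hc]; exact hF') hS']
  have h := (written_comp_eventuallyEq hS p).fderiv (𝕜 := ℝ)
  rw [h.fderiv_eq]
  let j : EuclideanSpace ℝ (Fin n) →L[ℝ] EuclideanSpace ℝ (Fin n) × ℝ :=
    ContinuousLinearMap.inl ℝ (EuclideanSpace ℝ (Fin n)) ℝ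
  have h2 : fderiv ℝ (fun x ↦ (writtenInExtChartAt (𝓡 m) (𝓡 n) p (levelSetMap F ε) x, ε))
      =ᶠ[𝓝 (extChartAt (𝓡 m) p p)] fun x ↦ j.comp
        (fderiv ℝ (writtenInExtChartAt (𝓡 m) (𝓡 n) p (levelSetMap F ε)) x) := by
    filter_upwards [hs.eventually (by simp)] with x hx
    rw [((hx.differentiableAt two_ne_zero).hasFDerivAt.prodMk (hasFDerivAt_const ε _)).fderiv]
    rfl
  have hd : DifferentiableAt ℝ
      (fderiv ℝ (writtenInExtChartAt (𝓡 m) (𝓡 n) p (levelSetMap F ε))) (extChartAt (𝓡 m) p p) :=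
    (hs.fderiv_right (m := 1) (by norm_num)).differentiableAt one_ne_zero
  rw [h2.fderiv_eq, ((hasFDerivAt_const j _).clm_comp hd.hasFDerivAt).fderiv]
  simp [j]

end LevelSet

/-! ### From bilinear forms to matrices -/

section Gram

variable {n m : ℕ}

/-- The matrix of a bilinear form in the coordinate frame. -/
def gram (β : LinearMap.BilinForm ℝ (EuclideanSpace ℝ (Fin n))) : Matrix (Fin n) (Fin n) ℝ :=
  Matrix.of fun i k ↦ β (coordVector i) (coordVector k)

/-- The matrix of a linear map in the coordinate frames. -/
def frameMatrix (L : EuclideanSpace ℝ (Fin m) →L[ℝ] EuclideanSpace ℝ (Fin n)) :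
    Matrix (Fin n) (Fin m) ℝ :=
  Matrix.of fun i j ↦ L (coordVector j) i

theorem eq_sum_coordVector (x : EuclideanSpace ℝ (Fin n)) : x = ∑ i, x i • coordVector i := by
  have h := (EuclideanSpace.basisFun (Fin n) ℝ).sum_repr x
  simpa [coordVector] using h.symm

theorem gram_apply_eq (β : LinearMap.BilinForm ℝ (EuclideanSpace ℝ (Fin n)))
    (x y : EuclideanSpace ℝ (Fin n)) :
    β x y = ∑ i, ∑ k, x i * gram β i k * y k := by
  conv_lhs => rw [eq_sum_coordVector x, eq_sum_coordVector y]
  simp only [map_sum, LinearMap.sum_apply, map_smul, LinearMap.smul_apply, smul_eq_mul, gram,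
    Matrix.of_apply, Finset.mul_sum]
  rw [Finset.sum_comm]
  refine Finset.sum_congr rfl fun i _ ↦ Finset.sum_congr rfl fun k _ ↦ ?_
  ring

theorem gram_comp (β : LinearMap.BilinForm ℝ (EuclideanSpace ℝ (Fin n)))
    (L : EuclideanSpace ℝ (Fin m) →L[ℝ] EuclideanSpace ℝ (Fin n)) (i j : Fin m) :
    ((frameMatrix L)ᵀ * gram β * frameMatrix L) i j = β (L (coordVector i)) (L (coordVector j)) := by
  rw [gram_apply_eq, Finset.sum_comm]
  simp only [Matrix.mul_apply, Matrix.transpose_apply, frameMatrix, Matrix.of_apply,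
    Finset.sum_mul]

theorem frameMatrix_mulVec (L : EuclideanSpace ℝ (Fin m) →L[ℝ] EuclideanSpace ℝ (Fin n))
    (x : Fin m → ℝ) (i : Fin n) : (frameMatrix L *ᵥ x) i = L (WithLp.toLp 2 x) i := by
  conv_rhs => rw [eq_sum_coordVector (WithLp.toLp 2 x)]
  simp [Matrix.mulVec, dotProduct, frameMatrix, mul_comm]

theorem frameMatrix_mulVec_injective
    {L : EuclideanSpace ℝ (Fin m) →L[ℝ] EuclideanSpace ℝ (Fin n)} (hL : Function.Injective L) :
    Function.Injective (frameMatrix L).mulVec := by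
  intro x y hxy
  have h : L (WithLp.toLp 2 x) = L (WithLp.toLp 2 y) := by
    ext i
    rw [← frameMatrix_mulVec, ← frameMatrix_mulVec, hxy]
  exact WithLp.toLp_injective 2 (hL h)

theorem posDef_gram {β : LinearMap.BilinForm ℝ (EuclideanSpace ℝ (Fin n))}
    (hsymm : ∀ x y, β x y = β y x) (hpos : ∀ x, x ≠ 0 → 0 < β x x) : (gram β).PosDef := by
  refine Matrix.PosDef.of_dotProduct_mulVec_pos (Matrix.IsHermitian.ext fun i j ↦ ?_)
    fun x hx ↦ ?_
  · simp [gram, hsymm (coordVector j)]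
  · have h := hpos (WithLp.toLp 2 x) (by simpa using hx)
    rw [gram_apply_eq] at h
    refine h.trans_eq ?_
    simp [dotProduct, Matrix.mulVec, Finset.mul_sum, mul_assoc]

end Gram

theorem principalMultiplicity_eq {n : ℕ} (A : Matrix (Fin n) (Fin n) ℝ) (κ : ℝ) :
    principalMultiplicity A κ =
      Module.finrank ℝ (LinearMap.ker (A - κ • (1 : Matrix (Fin n) (Fin n) ℝ)).mulVecLin) := by
  have h : Module.End.eigenspace (Matrix.toLin' A) κ =
      LinearMap.ker (A - κ • (1 : Matrix (Fin n) (Fin n) ℝ)).mulVecLin := by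
    ext x
    rw [Module.End.mem_eigenspace_iff, LinearMap.mem_ker, Matrix.mulVecLin_apply,
      Matrix.toLin'_apply, Matrix.sub_mulVec, Matrix.smul_mulVec, Matrix.one_mulVec, sub_eq_zero]
  rw [principalMultiplicity, h]

/-! ### Decomposing a normal vector -/

section NormalDecomposition

/-- A vector orthogonal to a hyperplane is a multiple of the unit normal. -/
theorem eq_smul_of_orthogonal {E₀ E : Type*} [AddCommGroup E₀] [Module ℝ E₀]
    [AddCommGroup E] [Module ℝ E] [FiniteDimensional ℝ E₀] [FiniteDimensional ℝ E]
    (hdim : Module.finrank ℝ E = Module.finrank ℝ E₀ + 1) {β : LinearMap.BilinForm ℝ E}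
    (hpos : ∀ x, x ≠ 0 → 0 < β x x) {σ : E₀ →ₗ[ℝ] E} (hσ : Function.Injective σ)
    {η : E} (hη : β η η = 1) (hησ : ∀ u, β η (σ u) = 0) {x : E} (hx : ∀ u, β x (σ u) = 0) :
    x = β x η • η := by
  have hinj : Function.Injective (σ.coprod (LinearMap.toSpanSingleton ℝ E η)) := by
    rw [← LinearMap.ker_eq_bot, LinearMap.ker_eq_bot']
    rintro ⟨u, t⟩ h
    simp only [LinearMap.coprod_apply, LinearMap.toSpanSingleton_apply] at h
    have h1 := congrArg (β η) h
    simp only [map_add, map_smul, hησ, hη, zero_add, smul_eq_mul, mul_one, map_zero] at h1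
    rw [h1, zero_smul, add_zero] at h
    rw [hσ (h.trans (map_zero σ).symm), h1]
    rfl
  have hsurj := (LinearMap.injective_iff_surjective_of_finrank_eq_finrank
    (by simp [hdim])).1 hinj
  rw [← sub_eq_zero]
  by_contra hne
  -- The difference is orthogonal to `η` and to the range of `σ`. It is also a combination of them,
  -- hence orthogonal to itself.
  obtain ⟨⟨u, t⟩, hut⟩ := hsurj (x - β x η • η)
  refine (hpos _ hne).ne' ?_
  nth_rewrite 2 [← hut]
  simp [hx, hησ, hη]
  ring

end NormalDecomposition

/-! ### Fundamental forms of the hypersurface restricted to the level set -/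

section Hypersurface

variable {n m : ℕ} {N : Type*} [TopologicalSpace N] [ChartedSpace (EuclideanSpace ℝ (Fin n)) N]
  [IsManifold (𝓡 n) ∞ N]
  (g : Bundle.ContMDiffRiemannianMetric (𝓡 n) ∞ (EuclideanSpace ℝ (Fin n))
      (fun x : N ↦ TangentSpace (𝓡 n) x))
  {φ : N × ℝ → ℝ}

omit [IsManifold (𝓡 n) ∞ N] in
theorem formAt_conformalMetric (g : TangentForm (𝓡 n) N) (φ : N × ℝ → ℝ) (z : N × ℝ)
    (a b : EuclideanSpace ℝ (Fin n) × ℝ) :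
    formAt ((𝓡 n).prod 𝓘(ℝ, ℝ)) (conformalMetric g φ) z a b =
      (φ z ^ 2)⁻¹ * (formAt (𝓡 n) g z.1 a.1 b.1 + a.2 * b.2) := by
  rw [← formAt_productMetric]
  rfl

omit [IsManifold (𝓡 n) ∞ N] in
theorem formAt_sliceMetric (g : TangentForm (𝓡 n) N) (φ : N × ℝ → ℝ) (ε : ℝ) (x : N)
    (a b : EuclideanSpace ℝ (Fin n)) :
    formAt (𝓡 n) (sliceMetric g φ ε) x a b = (φ (x, ε) ^ 2)⁻¹ * formAt (𝓡 n) g x a b := rfl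

theorem formAt_inner_comm (x : N) (a b : EuclideanSpace ℝ (Fin n)) :
    formAt (𝓡 n) g.inner x a b = formAt (𝓡 n) g.inner x b a := g.symm x a b

theorem formAt_inner_pos (x : N) {a : EuclideanSpace ℝ (Fin n)} (ha : a ≠ 0) :
    0 < formAt (𝓡 n) g.inner x a a := g.pos x a ha

theorem formAt_conformalMetric_comm (z : N × ℝ) (a b : EuclideanSpace ℝ (Fin n) × ℝ) :
    formAt ((𝓡 n).prod 𝓘(ℝ, ℝ)) (conformalMetric g.inner φ) z a b =
      formAt ((𝓡 n).prod 𝓘(ℝ, ℝ)) (conformalMetric g.inner φ) z b a := by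
  rw [formAt_conformalMetric, formAt_conformalMetric, formAt_inner_comm, mul_comm a.2]

theorem formAt_conformalMetric_pos (hφ_pos : ∀ z, 0 < φ z) (z : N × ℝ)
    {a : EuclideanSpace ℝ (Fin n) × ℝ} (ha : a ≠ 0) :
    0 < formAt ((𝓡 n).prod 𝓘(ℝ, ℝ)) (conformalMetric g.inner φ) z a a := by
  rw [formAt_conformalMetric]
  refine mul_pos (inv_pos.2 (pow_pos (hφ_pos z) 2)) ?_
  by_cases h : a.1 = 0
  · have h2 : a.2 ≠ 0 := fun h2 ↦ ha (Prod.ext h h2)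
    rw [h]
    simpa using mul_self_pos.2 h2
  · exact add_pos_of_pos_of_nonneg (formAt_inner_pos g z.1 h) (mul_self_nonneg _)

variable {M : Type*} [TopologicalSpace M] [ChartedSpace (EuclideanSpace ℝ (Fin n)) M]
  {F : M → N × ℝ} {ε : ℝ} [ChartedSpace (EuclideanSpace ℝ (Fin m)) (levelSet F ε)]
  (hF : ContMDiff (𝓡 n) ((𝓡 n).prod 𝓘(ℝ, ℝ)) 2 F)
  (hS : ContMDiff (𝓡 m) (𝓡 n) 2 (Subtype.val : levelSet F ε → M)) (p : levelSet F ε)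

include hF hS in
theorem firstFundamentalForm_levelSet (u v : EuclideanSpace ℝ (Fin m)) :
    firstFundamentalForm ((𝓡 n).prod 𝓘(ℝ, ℝ)) (𝓡 n) (conformalMetric g.inner φ) F p
        (derivAt (𝓡 n) (𝓡 m) Subtype.val p u) (derivAt (𝓡 n) (𝓡 m) Subtype.val p v) =
      firstFundamentalForm (𝓡 n) (𝓡 m) (sliceMetric g.inner φ ε) (levelSetMap F ε) p u v := by
  have hp : (levelSetMap F ε p, ε) = F p := Prod.ext rfl p.2.symm
  rw [firstFundamentalForm, firstFundamentalForm, derivAt_levelSet hF hS,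
    derivAt_levelSet hF hS, formAt_conformalMetric, formAt_sliceMetric, hp]
  simp [levelSetMap]

include hF hS in
/-- The second fundamental form of a hypersurface, restricted to a level set. -/
theorem secondFundamentalForm_levelSet
    (hφ : ContMDiff ((𝓡 n).prod 𝓘(ℝ, ℝ)) 𝓘(ℝ, ℝ) 1 φ) (hφ_pos : ∀ z, 0 < φ z)
    {η : EuclideanSpace ℝ (Fin n)} {a s : ℝ}
    (hν : ∀ v, formAt (𝓡 n) g.inner (F p).1
        (derivAt ((𝓡 n).prod 𝓘(ℝ, ℝ)) (𝓡 n) F p v).1 (a • η) +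
      (derivAt ((𝓡 n).prod 𝓘(ℝ, ℝ)) (𝓡 n) F p v).2 * s = 0)
    (u v : EuclideanSpace ℝ (Fin m)) :
    secondFundamentalForm ((𝓡 n).prod 𝓘(ℝ, ℝ)) (𝓡 n) (conformalMetric g.inner φ) F p
        (φ (F p) • (a • η, s))
        (derivAt (𝓡 n) (𝓡 m) Subtype.val p u) (derivAt (𝓡 n) (𝓡 m) Subtype.val p v) =
      a * secondFundamentalForm (𝓡 n) (𝓡 m) (sliceMetric g.inner φ ε) (levelSetMap F ε) p
          (φ (F p) • η) u v +
        s * derivT φ (F p) *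
          firstFundamentalForm (𝓡 n) (𝓡 m) (sliceMetric g.inner φ ε) (levelSetMap F ε) p u v := by
  have : IsManifold (𝓡 n) 1 N := IsManifold.of_le (n := ∞) (by simp)
  have hp : (F p).2 = ε := p.2
  have hp' : ((F p).1, ε) = F p := Prod.ext rfl p.2.symm
  have hpos := (hφ_pos (F p)).ne'
  have hdd := eq_sub_of_add_eq (fderiv_fderiv_levelSet hF hS p u v)
  rw [secondFundamentalForm, secondFundamentalForm, hdd, derivAt_levelSet hF hS,
    derivAt_levelSet hF hS, firstFundamentalForm]
  rw [Prod.smul_mk, christoffel_conformalMetric g hφ hφ_pos, hp]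
  have hchr (c : ℝ) (x y w : EuclideanSpace ℝ (Fin n)) :
      christoffel (𝓡 n) (sliceMetric g.inner φ ε) (F p).1 x y (c • w) =
        c * christoffel (𝓡 n) (sliceMetric g.inner φ ε) (F p).1 x y w := by
    simp only [christoffel, map_smul, _root_.smul_apply, smul_eq_mul]
    ring
  have hlev : levelSetMap F ε p = (F p).1 := rfl
  set D := fderiv ℝ (fderiv ℝ (writtenInExtChartAt (𝓡 m) (𝓡 n) p (Subtype.val : levelSet F ε → M)))
    (extChartAt (𝓡 m) p p) u v with hD
  -- `dF D` is tangent to `M`, so this term pairs to zero with the normal. In the Christoffel term,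
  -- the factor `φ` of the normal cancels the `1 / φ` in front of `φ_t`.
  have hνD := hν D
  simp only [hlev, formAt_conformalMetric, formAt_sliceMetric, hp', hchr]
  simp only [Prod.fst_sub, Prod.snd_sub, map_sub, map_smul, smul_eq_mul,
    _root_.sub_apply] at hνD ⊢
  field_simp
  linear_combination (-φ (F p)) * hνD

end Hypersurface

/-! ### The inequality and its equality case -/

theorem theorem1p4
    {n : ℕ} (hn : 2 ≤ n)
    -- the Riemannian manifold `(N, g)`
    {N : Type*} [TopologicalSpace N] [ChartedSpace (EuclideanSpace ℝ (Fin n)) N]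
    [IsManifold (𝓡 n) ∞ N]
    (g : Bundle.ContMDiffRiemannianMetric (𝓡 n) ∞ (EuclideanSpace ℝ (Fin n))
      (fun x : N ↦ TangentSpace (𝓡 n) x))
    -- the conformal factor
    (φ : N × ℝ → ℝ) (hφ : ContMDiff ((𝓡 n).prod 𝓘(ℝ, ℝ)) 𝓘(ℝ, ℝ) 1 φ) (hφ_pos : ∀ z, 0 < φ z)
    -- the `C²` hypersurface `M` (immersed by `F`, in particular possibly embedded)
    {M : Type*} [TopologicalSpace M] [ChartedSpace (EuclideanSpace ℝ (Fin n)) M]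
    [IsManifold (𝓡 n) 2 M]
    (F : M → N × ℝ) (hF : IsC2Immersion ((𝓡 n).prod 𝓘(ℝ, ℝ)) (𝓡 n) F)
    -- the regular level set `Σ`, with its structure of a `C²` submanifold of `M`
    (ε : ℝ) (hε : IsRegularLevel n F ε)
    [ChartedSpace (EuclideanSpace ℝ (Fin (n - 1))) (levelSet F ε)]
    [IsManifold (𝓡 (n - 1)) 2 (levelSet F ε)]
    (hS : IsC2Immersion (𝓡 n) (𝓡 (n - 1)) (Subtype.val : levelSet F ε → M))
    -- the unit normals `ν` to `M` in `(N × ℝ, g + dt²)` and `η` to `Σ` in `(N × {ε}, g)`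
    (ν : ∀ p : M, TangentSpace ((𝓡 n).prod 𝓘(ℝ, ℝ)) (F p))
    (hν : ∀ p, IsUnitNormalAt ((𝓡 n).prod 𝓘(ℝ, ℝ)) (𝓡 n) (productMetric g.inner) F p (ν p))
    (η : ∀ p : levelSet F ε, TangentSpace (𝓡 n) (levelSetMap F ε p))
    (hη : ∀ p, IsUnitNormalAt (𝓡 n) (𝓡 (n - 1)) g.inner (levelSetMap F ε) p (η p))
    -- an arbitrary point of `Σ`
    (p : levelSet F ε) :
    -- shape operators for the conformal metrics, with respect to the unit normals `φ ν` and `φ η`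
    let A : Matrix (Fin n) (Fin n) ℝ :=
      shapeMatrix ((𝓡 n).prod 𝓘(ℝ, ℝ)) (conformalMetric g.inner φ) F p (φ (F p) • ν p)
    let AS : Matrix (Fin (n - 1)) (Fin (n - 1)) ℝ :=
      shapeMatrix (𝓡 n) (sliceMetric g.inner φ ε) (levelSetMap F ε) p (φ (F p) • η p)
    let νη : ℝ := productMetric g.inner (F p) (ν p) (sliceVector (F p) (η p))
    let νt : ℝ := productMetric g.inner (F p) (ν p) (partialT (F p))
    let φt : ℝ := derivT φ (F p)
    let B : ℝ := νη * AS.trace + ((n : ℝ) - 1) * νt * φt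
    A.trace * B ≥ (1 / 2) * (A.trace ^ 2 - shapeNormSq A) + (n : ℝ) / (2 * ((n : ℝ) - 1)) * B ^ 2 ∧
    (A.trace * B = (1 / 2) * (A.trace ^ 2 - shapeNormSq A)
          + (n : ℝ) / (2 * ((n : ℝ) - 1)) * B ^ 2 ↔
      ∃ κ : ℝ, IsUmbilicWith AS κ ∧ n - 1 ≤ principalMultiplicity A (νη * κ + νt * φt)) := by
  intro A AS νη νt φt B
  have : IsManifold (𝓡 n) 1 N := IsManifold.of_le (n := ∞) (by simp)
  obtain ⟨hF2, hFinj⟩ := hF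
  obtain ⟨hS2, hSinj⟩ := hS
  let J := (𝓡 n).prod 𝓘(ℝ, ℝ)
  let D := derivAt J (𝓡 n) F p
  let L := derivAt (𝓡 n) (𝓡 (n - 1)) (Subtype.val : levelSet F ε → M) p
  let S := derivAt (𝓡 n) (𝓡 (n - 1)) (levelSetMap F ε) p
  let w : EuclideanSpace ℝ (Fin n) × ℝ := ν p
  let η' : EuclideanSpace ℝ (Fin n) := η p
  let γ := formAt (𝓡 n) g.inner (F p).1
  have hD : Function.Injective D := hFinj p
  have hL : Function.Injective L := hSinj p
  have hDL (u : EuclideanSpace ℝ (Fin (n - 1))) : D (L u) = (S u, 0) :=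
    derivAt_levelSet hF2 hS2 p u
  have hSi : Function.Injective S := by
    intro u v huv
    refine hL (hD ?_)
    rw [hDL, hDL, huv]
  have hww : γ w.1 w.1 + w.2 * w.2 = 1 := by
    rw [← formAt_productMetric]; exact (hν p).1
  have hwD (v : EuclideanSpace ℝ (Fin n)) : γ w.1 (D v).1 + w.2 * (D v).2 = 0 := by
    rw [← formAt_productMetric]; exact (hν p).2 v
  have hηη : γ η' η' = 1 := (hη p).1
  have hηS (u : EuclideanSpace ℝ (Fin (n - 1))) : γ η' (S u) = 0 := (hη p).2 u
  have hwS (u : EuclideanSpace ℝ (Fin (n - 1))) : γ w.1 (S u) = 0 := by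
    simpa [hDL] using hwD (L u)
  have hνη : νη = γ w.1 η' := by
    have h := formAt_productMetric g.inner (F p) w (η', 0)
    rw [mul_zero, add_zero] at h
    exact h
  have hνt : νt = w.2 := by
    have h := formAt_productMetric g.inner (F p) w (0, 1)
    rw [map_zero, zero_add, mul_one] at h
    exact h
  let β : LinearMap.BilinForm ℝ (EuclideanSpace ℝ (Fin n)) :=
    LinearMap.mk₂ ℝ (fun a b ↦ γ a b) (by simp) (by simp) (by simp) (by simp)
  -- Tangent vectors of `Σ` are horizontal, so the horizontal part of `ν` is orthogonal to the
  -- hyperplane `TΣ` of `TN` and is a multiple of `η`.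
  have hw : w = (νη • η', νt) := by
    refine Prod.ext ?_ hνt.symm
    rw [hνη]
    exact eq_smul_of_orthogonal (E₀ := EuclideanSpace ℝ (Fin (n - 1))) (β := β)
      (σ := S.toLinearMap) (by simp; omega) (fun x hx ↦ formAt_inner_pos g _ hx) hSi hηη hηS hwS
  -- Otherwise `ν` is vertical and nonzero, so orthogonality to `TM` makes the differential of `t ∘
  -- F` vanish, against regularity.
  have hα : νη ≠ 0 := by
    intro h0
    have hw1 : w.1 = 0 := by rw [hw, h0, zero_smul]
    have hw2 : w.2 ≠ 0 := by
      intro h; rw [hw1, h] at hww; simp at hww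
    refine hε p p.2 ?_
    have hcomp : mfderiv (𝓡 n) 𝓘(ℝ, ℝ) (fun q ↦ (F q).2) (p : M) =
        (mfderiv J 𝓘(ℝ, ℝ) Prod.snd (F p)).comp (mfderiv (𝓡 n) J F p) :=
      mfderiv_comp (p : M) mdifferentiableAt_snd ((hF2 p).mdifferentiableAt two_ne_zero)
    rw [hcomp, mfderiv_snd]
    refine ContinuousLinearMap.ext fun v ↦ ?_
    have h := hwD v
    rw [hw1, map_zero, zero_apply, zero_add] at h
    exact (mul_eq_zero.1 h).resolve_left hw2
  let h := conformalMetric g.inner φ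
  let hs := sliceMetric g.inner φ ε
  have hG : (gram (firstForm (I := J) (I' := 𝓡 n) h F p)).PosDef :=
    posDef_gram (fun x y ↦ formAt_conformalMetric_comm g (F p) _ _) fun x hx ↦
      formAt_conformalMetric_pos g hφ_pos (F p) (a := D x) fun h0 ↦
        hx (hD (h0.trans (map_zero D).symm))
  have hGS : (frameMatrix L)ᵀ * gram (firstForm (I := J) (I' := 𝓡 n) h F p) * frameMatrix L =
      gram (firstForm (I := 𝓡 n) (I' := 𝓡 (n - 1)) hs (levelSetMap F ε) p) := by
    ext i j
    rw [gram_comp]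
    exact firstFundamentalForm_levelSet g hF2 hS2 p _ _
  have hK : (gram (secondForm (I := J) (I' := 𝓡 n) h F p (φ (F p) • w)))ᵀ =
      gram (secondForm (I := J) (I' := 𝓡 n) h F p (φ (F p) • w)) := by
    ext i j
    exact secondFundamentalForm_comm (fun z ↦ formAt_conformalMetric_comm g z) (hF2 p) _ _ _
  -- The restricted form has the shape required by the algebraic inequality, with `α = ⟨ν,η⟩` and `β
  -- = ⟨ν,∂_t⟩ φ_t`.
  have hres : (frameMatrix L)ᵀ * gram (secondForm (I := J) (I' := 𝓡 n) h F p (φ (F p) • w)) *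
      frameMatrix L =
      νη • gram (secondForm (I := 𝓡 n) (I' := 𝓡 (n - 1)) hs (levelSetMap F ε) p (φ (F p) • η')) +
      (νt * φt) • ((frameMatrix L)ᵀ * gram (firstForm (I := J) (I' := 𝓡 n) h F p) *
        frameMatrix L) := by
    ext i j
    rw [hGS, gram_comp, hw]
    refine secondFundamentalForm_levelSet g hF2 hS2 p hφ hφ_pos (fun v ↦ ?_) _ _
    have h1 := hwD v
    rw [hw] at h1
    rw [formAt_inner_comm, mul_comm]
    exact h1
  -- `2 ≤ n` makes the truncated subtraction exact; below it also makes `n - 1` positive.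
  have hn1 : ((n - 1 : ℕ) : ℝ) = (n : ℝ) - 1 := by
    rw [Nat.cast_sub (by omega), Nat.cast_one]
  have key := hG.trace_inequality hK (by simp; omega) (by simp; omega)
    (frameMatrix_mulVec_injective hL) hα hres (A := A) rfl (A' := AS) (by rw [hGS]; rfl)
    (B := B) (by simp only [Fintype.card_fin, hn1, B]; ring)
  simp only [Fintype.card_fin, hn1] at key
  simp only [principalMultiplicity_eq, IsUmbilicWith, shapeNormSq]
  exact key

end
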